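/- Let $n,k\ge 1$ be integers. Let $J^k(\mathbb R^n)$ be the space of $k$-jets of $C^k$ functions $f:\mathbb R^n\to\mathbb R$, with global coordinates $(x,(u_I)_{|I|\le k})$, where $I\in\mathbb N^n$ runs over the multi-indices with $|I|=i_1+\dots+i_n\le k$ and the jet of $f$ at $x_0$ has coordinates $x=x_0$, $u_I=\partial_I f(x_0)$. Put $$X_i=\partial_{x_i}+\sum_{|I|\le k-1}u_{I+e_i}\,\partial_{u_I},\qquad i=1,\dots,n,$$ let $g_0$ be the Riemannian metric on $J^k(\mathbb R^n)$ for which the frame consisting of the $X_i$ $(1\le i\le n)$ and the $\partial_{u_I}$ $(|I|\le k)$ is orthonormal, and call a $C^1$ curve horizontal if at every point its tangent vector belongs to the span of $X_1,\dots,X_n$ and the $\partial_{u_I}$ with $|I|=k$. Let $d_c$ be the Carnot–Carathéodory distance $$d_c(p,q)=\inf\{\mathrm{length}_{g_0}(\gamma):\ \gamma \text{ a horizontal } C^1 \text{ curve joining } p \text{ to } q\}.$$ Then there is a Lipschitz map $f:S^n\to (J^k(\mathbb R^n),d_c)$, defined on the unit sphere $S^n\subset\mathbb R^{n+1}$, which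 does not admit any Lipschitz extension $\bar f:\bar D^{n+1}\to (J^k(\mathbb R^n),d_c)$ to the closed unit ball $\bar D^{n+1}\subset\mathbb R^{n+1}$, where $S^n$ and $\bar D^{n+1}$ carry the Euclidean distance. -/

import Mathlib

open scoped NNReal ENNReal

noncomputable section

/-- Multi-indices `I = (i₁, …, iₙ)` of degree `|I| = i₁ + ⋯ + iₙ ≤ k`; the `j`-indices are those
with `|I| = j`. -/
abbrev JetIndex (n k : ℕ) : Type := {I : Fin n → ℕ // ∑ i, I i ≤ k}

instance JetIndex.instFintype (n k : ℕ) : Fintype (JetIndex n k) :=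
  Fintype.ofInjective
    (fun (I : JetIndex n k) (i : Fin n) =>
      (⟨I.1 i, Nat.lt_succ_of_le
        ((Finset.single_le_sum (f := I.1) (fun _ _ => Nat.zero_le _) (Finset.mem_univ i)).trans
          I.2)⟩ : Fin (k + 1)))
    (by
      intro I J h
      apply Subtype.ext
      funext i
      exact congrArg Fin.val (congrFun h i))

/-- The `k`-jet space `J^k(ℝⁿ)` in its global coordinates `(x, (u_I)_{|I| ≤ k})`: the jet at `x₀` of
a `C^k` function `f` has coordinates `x = x₀` and `u_I = ∂_I f(x₀)`. The component `u^j` is the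
family of the `u_I` with `|I| = j`. Each tangent space is identified with the same vector space.
The product (sup) norm that this type carries is used only for its topology and for
differentiability. -/
abbrev JetSpace (n k : ℕ) : Type := (Fin n → ℝ) × (JetIndex n k → ℝ)

namespace JetSpace

variable {n k : ℕ}

/-- The multi-index `I + e_i`, for `|I| < k`. -/
def raise (I : JetIndex n k) (i : Fin n) (h : ∑ j, I.1 j < k) : JetIndex n k :=
  ⟨I.1 + Pi.single i 1, by
    simp only [Pi.add_apply, Finset.sum_add_distrib, Finset.sum_pi_single', Finset.mem_univ,
      if_true]
    exact h⟩

/-- The vector field `X_i = ∂_{x_i} + ∑_{|I| < k} u_{I + e_i} ∂_{u_I}`. -/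
def X (i : Fin n) (p : JetSpace n k) : JetSpace n k :=
  (Pi.single i 1, fun I => if h : ∑ j, I.1 j < k then p.2 (raise I i h) else 0)

/-- The constant vector field `∂_{u_I}`. -/
def dU (I : JetIndex n k) : JetSpace n k := (0, Pi.single I 1)

/-- The horizontal space at `p`, spanned by the `X_i(p)` and the `∂_{u_I}` with `|I| = k`. -/
def horizontal (p : JetSpace n k) : Submodule ℝ (JetSpace n k) :=
  Submodule.span ℝ (Set.range (fun i => X i p) ∪ dU '' {I : JetIndex n k | ∑ j, I.1 j = k})

/-- The coefficient of `∂_{u_I}` in the expansion of a tangent vector `v` at `p` with respect to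
the frame `(X_i(p), ∂_{u_I})`. The coefficient of `X_i(p)` is `v.1 i`. -/
def coeffU (p v : JetSpace n k) (I : JetIndex n k) : ℝ :=
  v.2 I - ∑ i, v.1 i * (X i p).2 I

theorem frame_expansion (p v : JetSpace n k) :
    v = ∑ i, v.1 i • X i p + ∑ I, coeffU p v I • dU I := by
  refine Prod.ext ?_ ?_
  · funext j
    simp [X, dU, Prod.fst_sum, Finset.sum_apply, Pi.single_apply]
  · funext J
    simp [coeffU, dU, Prod.snd_sum, Finset.sum_apply, Pi.single_apply]

/-- The Riemannian metric `g₀`, for which the frame `(X_i, ∂_{u_I})` is orthonormal. -/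
def g0 (p v w : JetSpace n k) : ℝ :=
  ∑ i, v.1 i * w.1 i + ∑ I, coeffU p v I * coeffU p w I

theorem g0_X_X (p : JetSpace n k) (i j : Fin n) :
    g0 p (X i p) (X j p) = if i = j then 1 else 0 := by
  simp [g0, coeffU, X, Pi.single_apply, eq_comm]

theorem g0_X_dU (p : JetSpace n k) (i : Fin n) (J : JetIndex n k) :
    g0 p (X i p) (dU J) = 0 := by
  simp [g0, coeffU, X, dU, Pi.single_apply]

theorem g0_dU_dU (p : JetSpace n k) (I J : JetIndex n k) :
    g0 p (dU I) (dU J) = if I = J then 1 else 0 := by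
  simp [g0, coeffU, dU, Pi.single_apply, eq_comm]

/-- The velocity at time `t` of a curve parametrized by `[0, 1]` (one-sided at the endpoints). -/
def velocity (γ : ℝ → JetSpace n k) (t : ℝ) : JetSpace n k :=
  derivWithin γ (Set.Icc 0 1) t

/-- `γ`, restricted to `[0, 1]`, is a horizontal `C¹` curve joining `p` to `q`. -/
structure IsHorizontalCurve (γ : ℝ → JetSpace n k) (p q : JetSpace n k) : Prop where
  contDiffOn : ContDiffOn ℝ 1 γ (Set.Icc 0 1)
  source : γ 0 = p
  target : γ 1 = q
  horizontal : ∀ t ∈ Set.Icc (0 : ℝ) 1, velocity γ t ∈ JetSpace.horizontal (γ t)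

/-- The length with respect to `g₀` of a `C¹` curve parametrized by `[0, 1]`. -/
def length (γ : ℝ → JetSpace n k) : ℝ :=
  ∫ t in (0 : ℝ)..1, Real.sqrt (g0 (γ t) (velocity γ t) (velocity γ t))

/-- The Carnot–Carathéodory distance `d_c(p, q)`: the infimum of the `g₀`-lengths of the horizontal
`C¹` curves joining `p` to `q`, as an extended nonnegative real (an infimum over the empty family
would be `∞`). -/
def dc (p q : JetSpace n k) : ℝ≥0∞ :=
  ⨅ (γ : ℝ → JetSpace n k) (_ : IsHorizontalCurve γ p q), ENNReal.ofReal (length γ)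

/-- `f` is a Lipschitz map from the metric space `S` to `(J^k(ℝⁿ), d_c)`. -/
def IsLipschitz {S : Type*} [MetricSpace S] (f : S → JetSpace n k) : Prop :=
  ∃ K : ℝ≥0, ∀ x y : S, dc (f x) (f y) ≤ K * edist x y

end JetSpace

end

/-!
The jet space projects to `ℝⁿ⁺¹` by `(x, u) ↦ (u₀, x)`, where `u₀` is the coordinate with zero
multi-index. A Lipschitz map `g` into `(J^k(ℝⁿ), d_c)` satisfies `du₀ = ∑ u_{e_i} dx_i` at every point
where its projection `G` is differentiable (`ConnectsOn.hasFDerivAt_contact`), because along a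
horizontal curve of length `ℓ` the contact form frozen at the starting point changes only by
`O(ℓ²)`. Hence `det DG = 0` wherever `G` is differentiable (`ConnectsOn.det_fderiv_toGraph_eq_zero`).
Moreover `G` is Lipschitz in the Euclidean sense on compact sets (`ConnectsOn.lipschitzOnWith`).

On the other hand the integral of the Jacobian determinant of a Lipschitz map over the ball depends
only on its values on the sphere. Instead of Stokes' theorem, the argument for this is that of
Milnor and Rogers: if `V` is Lipschitz and vanishes off `B`, then for small `s` the map `id + sV`
permutes `B`, so `∫_B det (1 + s DV) = vol B` by the change of variables formula; the integrand is
polynomial in `s`, so the identity persists at `s = 1` (`setIntegral_det_id_add_of_lipschitzWith`).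

It remains to find a smooth map `F` into jet space, defined on all of `ℝⁿ⁺¹`, that is horizontal along
the sphere and whose projection has nonzero total Jacobian over the ball. Let `β ≥ 0` be a smooth
bump with small support, `θ' = β`, `φ(x) = β(x₁) ⋯ β(xₙ)`, and
`F(t, x) = (x, (θ(t) ∂_I φ(x))_I)` (`bumpJet`). The contact forms on `F` differ from zero by
`θ'(t) ∂_I φ(x) dt`, which vanishes unless all the coordinates of `(t, x)` are small, in particular on
the sphere. The projection `(t, x) ↦ (θ(t) φ(x), x)` has Jacobian `β(t) φ(x)`, whose integral over the
ball is positive. The restriction of `F` to the sphere is Lipschitz for `d_c` since it maps arcs of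
great circles to horizontal curves.
-/

open MeasureTheory Set Metric
open scoped NNReal ENNReal

/-! ### The Jacobian of a Lipschitz perturbation of the identity -/

section Degree

variable {E : Type*} [NormedAddCommGroup E] [NormedSpace ℝ E] [FiniteDimensional ℝ E]

theorem exists_polynomial_eval_eq_det_id_add_smul (A : E →L[ℝ] E) :
    ∃ P : Polynomial ℝ, P.natDegree ≤ Module.finrank ℝ E ∧
      ∀ s : ℝ, P.eval s = (ContinuousLinearMap.id ℝ E + s • A).det := by
  classical
  let b := Module.finBasis ℝ E
  let M := LinearMap.toMatrix b b (A : E →ₗ[ℝ] E)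
  refine ⟨Matrix.det ((Polynomial.X : Polynomial ℝ) • M.map Polynomial.C +
    (1 : Matrix _ _ ℝ).map Polynomial.C), ?_, fun s => ?_⟩
  · simpa using Polynomial.natDegree_det_X_add_C_le M 1
  · have h : (ContinuousLinearMap.id ℝ E + s • A).det =
        (LinearMap.toMatrix b b (LinearMap.id + s • (A : E →ₗ[ℝ] E))).det := by
      rw [LinearMap.det_toMatrix]; rfl
    rw [h, map_add, map_smul, LinearMap.toMatrix_id, ← Polynomial.coe_evalRingHom, RingHom.map_det]
    congr 1
    ext i j
    simp [M, Matrix.one_apply, add_comm]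
    split_ifs <;> simp [mul_comm]

/-- As `s ↦ det (1 + s A)` is a polynomial of degree at most `dim E`, Lagrange interpolation at
`dim E + 1` nodes arbitrarily close to `0` expresses its value at `s = 1`. -/
theorem exists_det_id_add_eq_sum {ε : ℝ} (hε : 0 < ε) :
    ∃ s c : Fin (Module.finrank ℝ E + 1) → ℝ, (∀ j, 0 ≤ s j ∧ s j < ε) ∧ ∑ j, c j = 1 ∧
      ∀ A : E →L[ℝ] E, (ContinuousLinearMap.id ℝ E + A).det =
        ∑ j, c j * (ContinuousLinearMap.id ℝ E + s j • A).det := by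
  classical
  set N := Module.finrank ℝ E
  let s : Fin (N + 1) → ℝ := fun j => ε * (j : ℝ) / (N + 1)
  have hs : Function.Injective s := by
    intro i j h
    simp only [s] at h
    have : (0 : ℝ) < N + 1 := by positivity
    field_simp at h
    exact Fin.ext (by exact_mod_cast h)
  let c : Fin (N + 1) → ℝ := fun j => (Lagrange.basis Finset.univ s j).eval 1
  have key : ∀ P : Polynomial ℝ, P.natDegree ≤ N → P.eval 1 = ∑ j, c j * P.eval (s j) := by
    intro P hP
    have hd : P.degree < (Finset.univ : Finset (Fin (N + 1))).card := by
      refine lt_of_le_of_lt Polynomial.degree_le_natDegree ?_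
      simp only [Finset.card_univ, Fintype.card_fin]
      exact_mod_cast Nat.lt_succ_of_le hP
    conv_lhs => rw [Lagrange.eq_interpolate hs.injOn hd]
    simp [Lagrange.interpolate_apply, Polynomial.eval_finsetSum, c, mul_comm]
  refine ⟨s, c, fun j => ⟨by positivity, ?_⟩, ?_, fun A => ?_⟩
  · simp only [s]
    rw [div_lt_iff₀ (by positivity)]
    have : (j : ℝ) < N + 1 := by exact_mod_cast j.2
    gcongr
  · simpa using (key 1 (by simp)).symm
  · obtain ⟨P, hP, hPs⟩ := exists_polynomial_eval_eq_det_id_add_smul A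
    simpa [hPs] using key P hP

variable [MeasurableSpace E] [BorelSpace E] (μ : Measure E) [μ.IsAddHaarMeasure]

theorem LipschitzWith.addHaar_image_eq_zero {K : ℝ≥0} {f : E → E} (hf : LipschitzWith K f)
    {s : Set E} (hs : μ s = 0) : μ (f '' s) = 0 := by
  have h1 : μ ≪ μH[Module.finrank ℝ E] := Measure.absolutelyContinuous_isAddHaarMeasure _ _
  have h2 : μH[Module.finrank ℝ E] ≪ μ := Measure.absolutelyContinuous_isAddHaarMeasure _ _
  refine h1 ?_
  have := hf.hausdorffMeasure_image_le (d := Module.finrank ℝ E) (by positivity) s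
  rw [h2 hs, mul_zero] at this
  exact le_antisymm this bot_le

/-- A small Lipschitz perturbation of the identity that is supported in `B` permutes `B`, so the
change of variables formula computes the integral of its Jacobian. -/
theorem setIntegral_det_id_add_of_lipschitzWith_small : ∃ δ > 0, ∀ {K : ℝ≥0} {V : E → E}
    {B : Set E}, (K : ℝ) < δ → LipschitzWith K V → MeasurableSet B → (∀ x ∉ B, V x = 0) →
    ∫ x in B, (ContinuousLinearMap.id ℝ E + fderiv ℝ V x).det ∂μ = μ.real B := by
  obtain ⟨δ, hδ, hdet⟩ : ∃ δ > 0, ∀ A : E →L[ℝ] E, ‖A‖ < δ →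
      0 < (ContinuousLinearMap.id ℝ E + A).det := by
    have hc : Continuous fun A : E →L[ℝ] E => (ContinuousLinearMap.id ℝ E + A).det :=
      ContinuousLinearMap.continuous_det.comp (continuous_const.add continuous_id)
    have h0 : (0 : ℝ) < (ContinuousLinearMap.id ℝ E + (0 : E →L[ℝ] E)).det := by
      rw [add_zero]
      simp [ContinuousLinearMap.det]
    obtain ⟨δ, hδ, h⟩ := Metric.eventually_nhds_iff.1 (hc.continuousAt.eventually (lt_mem_nhds h0))
    exact ⟨δ, hδ, fun A hA => h (by simpa using hA)⟩
  refine ⟨min δ 1, by positivity, fun {K V B} hK hV hB hV0 => ?_⟩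
  set T : E → E := fun x => x + V x
  have hT : ApproximatesLinearOn T
      ((ContinuousLinearEquiv.refl ℝ E : E ≃L[ℝ] E) : E →L[ℝ] E) univ K := by
    intro x _ y _
    have h : T x - T y - (x - y) = V x - V y := by simp only [T]; abel
    simpa [h] using hV.norm_sub_le x y
  have hsmall : Subsingleton E ∨
      K < ‖((ContinuousLinearEquiv.refl ℝ E).symm : E →L[ℝ] E)‖₊⁻¹ := by
    rcases subsingleton_or_nontrivial E with h | h
    · exact Or.inl h
    · right
      have h1 : ‖((ContinuousLinearEquiv.refl ℝ E).symm : E →L[ℝ] E)‖₊ = 1 :=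
        NNReal.eq ContinuousLinearMap.norm_id
      rw [h1, inv_one]
      exact_mod_cast hK.trans_le (min_le_right _ _)
  have hinj : Function.Injective T := (injOn_univ).1 (hT.injOn hsmall)
  have hsurj : Function.Surjective T := hT.surjective hsmall
  have hfix : ∀ x ∉ B, T x = x := fun x hx => by simp [T, hV0 x hx]
  have himage : T '' B = B := by
    ext y
    constructor
    · rintro ⟨x, hx, rfl⟩
      by_contra hy
      rw [hinj (hfix _ hy)] at hy
      exact hy hx
    · intro hy
      obtain ⟨x, rfl⟩ := hsurj y
      by_contra hx
      have hxB : x ∉ B := fun h => hx ⟨x, h, rfl⟩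
      rw [hfix x hxB] at hy
      exact hxB hy
  set D : Set E := {x | DifferentiableAt ℝ V x}
  have hDm : MeasurableSet D := measurableSet_of_differentiableAt ℝ V
  have hDae : μ Dᶜ = 0 := hV.ae_differentiableAt
  have hTlip : LipschitzWith (1 + K) T := LipschitzWith.id.add hV
  have hnull : μ (T '' (B \ D)) = 0 :=
    hTlip.addHaar_image_eq_zero μ (measure_mono_null (fun x hx => hx.2) hDae)
  have hBD : μ (T '' (B ∩ D)) = μ B := by
    refine le_antisymm ?_ ?_
    · conv_rhs => rw [← himage]
      exact measure_mono (image_mono inter_subset_left)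
    · calc μ B = μ (T '' (B ∩ D) ∪ T '' (B \ D)) := by
            rw [← image_union, inter_union_sdiff, himage]
        _ ≤ μ (T '' (B ∩ D)) + μ (T '' (B \ D)) := measure_union_le _ _
        _ = μ (T '' (B ∩ D)) := by rw [hnull, add_zero]
  have hpos : ∀ x, 0 < (ContinuousLinearMap.id ℝ E + fderiv ℝ V x).det := fun x =>
    hdet _ ((norm_fderiv_le_of_lipschitz ℝ hV).trans_lt (hK.trans_le (min_le_left _ _)))
  have hcv := lintegral_abs_det_fderiv_eq_addHaar_image μ (hB.inter hDm)
    (f := T) (f' := fun x => ContinuousLinearMap.id ℝ E + fderiv ℝ V x)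
    (fun x hx => ((hasFDerivAt_id x).add hx.2.hasFDerivAt).hasFDerivWithinAt) hinj.injOn
  have hmeas : Measurable fun x => (ContinuousLinearMap.id ℝ E + fderiv ℝ V x).det :=
    ContinuousLinearMap.continuous_det.measurable.comp
      ((measurable_fderiv ℝ V).const_add (ContinuousLinearMap.id ℝ E))
  rw [integral_eq_lintegral_of_nonneg_ae (Filter.Eventually.of_forall fun x => (hpos x).le)
    hmeas.aestronglyMeasurable, Measure.real, ← hBD, ← hcv]
  congr 1
  have hBDae : (B : Set E) =ᵐ[μ] (B ∩ D : Set E) := by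
    have : D =ᵐ[μ] (univ : Set E) := Filter.eventuallyEq_univ.2 (mem_ae_iff.2 hDae)
    simpa using (Filter.EventuallyEq.refl _ B).inter this.symm
  rw [Measure.restrict_congr_set hBDae]
  refine lintegral_congr fun x => ?_
  rw [abs_of_pos (hpos x)]

/-- The Jacobian determinant of a Lipschitz map that is the identity off a set `B` of finite measure
has the same integral over `B` as that of the identity. -/
theorem setIntegral_det_id_add_of_lipschitzWith {K : ℝ≥0} {V : E → E} {B : Set E}
    (hV : LipschitzWith K V) (hB : MeasurableSet B) (hBfin : μ B ≠ ∞) (hV0 : ∀ x ∉ B, V x = 0) :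
    IntegrableOn (fun x => (ContinuousLinearMap.id ℝ E + fderiv ℝ V x).det) B μ ∧
    ∫ x in B, (ContinuousLinearMap.id ℝ E + fderiv ℝ V x).det ∂μ = μ.real B := by
  have hint : ∀ s : ℝ, IntegrableOn
      (fun x => (ContinuousLinearMap.id ℝ E + s • fderiv ℝ V x).det) B μ := by
    intro s
    have hc : Continuous fun A : E →L[ℝ] E => (ContinuousLinearMap.id ℝ E + s • A).det :=
      ContinuousLinearMap.continuous_det.comp (by fun_prop)
    obtain ⟨C, hC⟩ := (isCompact_closedBall (0 : E →L[ℝ] E) K).exists_bound_of_continuousOn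
      hc.continuousOn
    refine Measure.integrableOn_of_bounded hBfin
      (hc.measurable.comp (measurable_fderiv ℝ V)).aestronglyMeasurable (M := C)
      (Filter.Eventually.of_forall fun x => hC _ ?_)
    simpa using norm_fderiv_le_of_lipschitz ℝ hV
  refine ⟨by simpa using hint 1, ?_⟩
  obtain ⟨δ, hδ, hsmall⟩ := setIntegral_det_id_add_of_lipschitzWith_small (E := E) μ
  obtain ⟨s, c, hs, hc, hsum⟩ := exists_det_id_add_eq_sum (E := E)
    (show 0 < δ / (K + 1) by positivity)
  have hnode : ∀ j, ∫ x in B, (ContinuousLinearMap.id ℝ E + s j • fderiv ℝ V x).det ∂μ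
      = μ.real B := by
    intro j
    have hlip : LipschitzWith (‖s j‖₊ * K) (fun x => s j • V x) :=
      (lipschitzWith_smul (s j)).comp hV
    have hK : ((‖s j‖₊ * K : ℝ≥0) : ℝ) < δ := by
      have h1 := (lt_div_iff₀ (by positivity)).1 (hs j).2
      have h2 : ‖s j‖ = s j := Real.norm_of_nonneg (hs j).1
      push_cast
      rw [h2]
      nlinarith [(hs j).1]
    rw [← hsmall hK hlip hB (fun x hx => by simp [hV0 x hx])]
    have h : ∀ x, fderiv ℝ (fun x => s j • V x) x = s j • fderiv ℝ V x := fun x =>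
      congrFun (fderiv_const_smul_field (s j)) x
    simp_rw [h]
  rw [integral_congr_ae (Filter.Eventually.of_forall fun x => hsum (fderiv ℝ V x))]
  rw [integral_finsetSum _ fun j _ => (hint (s j)).const_mul _]
  simp_rw [integral_const_mul, hnode, ← Finset.sum_mul, hc, one_mul]

end Degree

/-! ### The Jacobian integral and boundary values -/

section BoundaryValues

variable {E : Type*} [NormedAddCommGroup E] [NormedSpace ℝ E]

theorem exists_mem_segment_norm_eq {x y : E} {r : ℝ} (hx : ‖x‖ ≤ r) (hy : r ≤ ‖y‖) :
    ∃ z ∈ segment ℝ x y, ‖z‖ = r := by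
  have := (convex_segment (𝕜 := ℝ) x y).isPreconnected.intermediate_value
    (left_mem_segment ℝ x y) (right_mem_segment ℝ x y) continuous_norm.continuousOn
  obtain ⟨z, hz, h⟩ := this ⟨hx, hy⟩
  exact ⟨z, hz, h⟩

open Classical in
/-- Gluing along a sphere: a segment from the inside to the outside of the ball meets the sphere,
where the two maps agree. -/
theorem LipschitzWith.piecewise_closedBall {F : Type*} [NormedAddCommGroup F] {K L : ℝ≥0}
    {f g : E → F} {r : ℝ} (hf : LipschitzOnWith K f (closedBall 0 r)) (hg : LipschitzWith L g)
    (hfg : ∀ x ∈ sphere (0 : E) r, f x = g x) :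
    LipschitzWith (K + L) ((closedBall (0 : E) r).piecewise f g) := by
  have hmix : ∀ x ∈ closedBall (0 : E) r, ∀ y ∉ closedBall (0 : E) r,
      dist (f x) (g y) ≤ (K + L) * dist x y := by
    intro x hx y hy
    obtain ⟨z, hz, hzr⟩ := exists_mem_segment_norm_eq (r := r) (by simpa using hx)
      (by simpa using (not_le.1 (by simpa using hy)).le)
    have hzs : z ∈ sphere (0 : E) r := by simpa using hzr
    have h1 := hf.dist_le_mul x hx z (sphere_subset_closedBall hzs)
    have h2 := hg.dist_le_mul z y
    have h3 := dist_add_dist_of_mem_segment hz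
    have h4 := dist_triangle (f x) (f z) (g y)
    rw [hfg z hzs] at h1 h4
    have h5 : (0 : ℝ) ≤ dist x z := dist_nonneg
    have h6 : (0 : ℝ) ≤ dist z y := dist_nonneg
    rw [← h3]
    nlinarith [K.2, L.2, mul_nonneg K.2 h6, mul_nonneg L.2 h5]
  refine LipschitzWith.of_dist_le_mul fun x y => ?_
  push_cast
  have hd : (0 : ℝ) ≤ dist x y := dist_nonneg
  by_cases hx : x ∈ closedBall (0 : E) r <;> by_cases hy : y ∈ closedBall (0 : E) r
  · rw [piecewise_eq_of_mem _ _ _ hx, piecewise_eq_of_mem _ _ _ hy]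
    nlinarith [hf.dist_le_mul x hx y hy, mul_nonneg L.2 hd]
  · rw [piecewise_eq_of_mem _ _ _ hx, piecewise_eq_of_notMem _ _ _ hy]
    exact hmix x hx y hy
  · rw [piecewise_eq_of_notMem _ _ _ hx, piecewise_eq_of_mem _ _ _ hy, dist_comm, dist_comm x]
    exact hmix y hy x hx
  · rw [piecewise_eq_of_notMem _ _ _ hx, piecewise_eq_of_notMem _ _ _ hy]
    nlinarith [hg.dist_le_mul x y, mul_nonneg K.2 hd]

variable [FiniteDimensional ℝ E]

/-- On the unit ball the displacement `F - id` agrees with a Lipschitz map of compact support. -/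
theorem exists_lipschitzWith_eq_sub_id {F : E → E} (hF : ContDiff ℝ 1 F) :
    ∃ (L : ℝ≥0) (Φ : E → E), LipschitzWith L Φ ∧ (∀ x ∈ closedBall (0 : E) 1, Φ x = F x - x) ∧
      ∀ x ∉ ball (0 : E) 2, Φ x = 0 := by
  let χ : ContDiffBump (0 : E) := ⟨1, 2, one_pos, one_lt_two⟩
  have hsm : ContDiff ℝ 1 fun x => χ x • (F x - x) := χ.contDiff.smul (hF.sub contDiff_id)
  obtain ⟨L, hL⟩ := ContDiff.lipschitzWith_of_hasCompactSupport (𝕂 := ℝ)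
    (χ.hasCompactSupport.smul_right) hsm one_ne_zero
  refine ⟨L, _, hL, fun x hx => ?_, fun x hx => ?_⟩
  · simp [χ.one_of_mem_closedBall hx]
  · have : χ x = 0 := by
      rw [← Function.notMem_support, χ.support_eq]
      exact hx
    simp [this]

variable [MeasurableSpace E] [BorelSpace E] (μ : Measure E) [μ.IsAddHaarMeasure]

/-- The integral of the Jacobian determinant over the unit ball depends only on the values on the
unit sphere, so it vanishes for `F` if `F` has the boundary values of a Lipschitz map `G` with zero
Jacobian. Both maps are continued outside the ball by the same map, equal to the identity outside a
larger ball; the two integrals over the larger ball are then equal. -/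
theorem setIntegral_det_fderiv_eq_zero [Nontrivial E] {F G : E → E} {K : ℝ≥0}
    (hF : ContDiff ℝ 1 F) (hG : LipschitzOnWith K G (closedBall 0 1))
    (hFG : ∀ x ∈ sphere (0 : E) 1, G x = F x)
    (hdet : ∀ x ∈ ball (0 : E) 1, DifferentiableAt ℝ G x → (fderiv ℝ G x).det = 0) :
    ∫ x in ball (0 : E) 1, (fderiv ℝ F x).det ∂μ = 0 := by
  classical
  obtain ⟨L, Φ, hΦ, hΦF, hΦ0⟩ := exists_lipschitzWith_eq_sub_id hF
  set V : E → E := (closedBall (0 : E) 1).piecewise (fun x => G x - x) Φ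
  have hV : LipschitzWith (K + 1 + L) V := by
    refine LipschitzWith.piecewise_closedBall (hG.sub LipschitzWith.id.lipschitzOnWith) hΦ ?_
    intro x hx
    simp only [hΦF x (sphere_subset_closedBall hx), hFG x hx]
  have hV0 : ∀ x ∉ ball (0 : E) 2, V x = 0 := by
    intro x hx
    have : x ∉ closedBall (0 : E) 1 := fun h => hx (closedBall_subset_ball one_lt_two h)
    simp only [V, piecewise_eq_of_notMem _ _ _ this, hΦ0 x hx]
  obtain ⟨hi1, he1⟩ := setIntegral_det_id_add_of_lipschitzWith μ hV measurableSet_ball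
    measure_ball_lt_top.ne hV0
  obtain ⟨hi2, he2⟩ := setIntegral_det_id_add_of_lipschitzWith μ hΦ measurableSet_ball
    measure_ball_lt_top.ne hΦ0
  have hsub : ball (0 : E) 1 ⊆ ball (0 : E) 2 := ball_subset_ball one_le_two
  have hout : ∫ x in ball (0 : E) 2 \ ball 0 1,
        (ContinuousLinearMap.id ℝ E + fderiv ℝ V x).det ∂μ =
      ∫ x in ball (0 : E) 2 \ ball 0 1, (ContinuousLinearMap.id ℝ E + fderiv ℝ Φ x).det ∂μ := by
    refine setIntegral_congr_ae (measurableSet_ball.diff measurableSet_ball) ?_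
    have hs : ∀ᵐ x ∂μ, x ∉ sphere (0 : E) 1 := measure_eq_zero_iff_ae_notMem.1
      (Measure.addHaar_sphere μ 0 1)
    filter_upwards [hs] with x hx hx2
    have hx1 : x ∈ (closedBall (0 : E) 1)ᶜ := by
      intro h
      rw [← ball_union_sphere] at h
      exact h.elim hx2.2 hx
    have : V =ᶠ[nhds x] Φ := by
      filter_upwards [isClosed_closedBall.isOpen_compl.mem_nhds hx1] with y hy
      exact piecewise_eq_of_notMem _ _ _ hy
    rw [this.fderiv_eq]
  have hin1 : ∫ x in ball (0 : E) 1, (ContinuousLinearMap.id ℝ E + fderiv ℝ V x).det ∂μ = 0 := by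
    refine setIntegral_eq_zero_of_ae_eq_zero ?_
    filter_upwards [hV.ae_differentiableAt (μ := μ)] with x hx hx1
    have hGV : G =ᶠ[nhds x] fun y => y + V y := by
      filter_upwards [isOpen_ball.mem_nhds hx1] with y hy
      simp only [V, piecewise_eq_of_mem _ _ _ (ball_subset_closedBall hy), add_sub_cancel]
    have hd := ((hasFDerivAt_id x).add hx.hasFDerivAt).congr_of_eventuallyEq hGV
    rw [← hdet x hx1 hd.differentiableAt, hd.fderiv]
  have hin2 : ∫ x in ball (0 : E) 1, (ContinuousLinearMap.id ℝ E + fderiv ℝ Φ x).det ∂μ =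
      ∫ x in ball (0 : E) 1, (fderiv ℝ F x).det ∂μ := by
    refine setIntegral_congr_fun measurableSet_ball fun x hx => ?_
    have hFΦ : Φ =ᶠ[nhds x] fun y => F y - y := by
      filter_upwards [isOpen_ball.mem_nhds hx] with y hy
      exact hΦF y (ball_subset_closedBall hy)
    have hd := ((hF.differentiable one_ne_zero x).hasFDerivAt.sub
      (hasFDerivAt_id x)).congr_of_eventuallyEq hFΦ
    simp only [hd.fderiv, add_sub_cancel]
  have h1 := setIntegral_sdiff (measurableSet_ball (x := (0 : E)) (ε := 1)) hi1 hsub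
  have h2 := setIntegral_sdiff (measurableSet_ball (x := (0 : E)) (ε := 1)) hi2 hsub
  rw [hin1, he1] at h1
  rw [hin2, he2] at h2
  linarith

end BoundaryValues

/-! ### Horizontal curves in jet space -/

namespace JetSpace

variable {n k : ℕ}

theorem X_snd_of_eq {I : JetIndex n k} (hI : ∑ j, I.1 j = k) (i : Fin n) (p : JetSpace n k) :
    (X i p).2 I = 0 := by
  simp [X, hI]

theorem X_snd_of_lt {I : JetIndex n k} (hI : ∑ j, I.1 j < k) (i : Fin n) (p : JetSpace n k) :
    (X i p).2 I = p.2 (raise I i hI) := by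
  simp [X, hI]

theorem coeffU_of_lt {I : JetIndex n k} (hI : ∑ j, I.1 j < k) (p v : JetSpace n k) :
    coeffU p v I = v.2 I - ∑ i, v.1 i * p.2 (raise I i hI) := by
  simp only [coeffU, X_snd_of_lt hI]

theorem abs_X_snd_le (i : Fin n) (p : JetSpace n k) (I : JetIndex n k) :
    |(X i p).2 I| ≤ ‖p‖ := by
  rcases lt_or_eq_of_le I.2 with h | h
  · rw [X_snd_of_lt h]
    exact (norm_le_pi_norm p.2 _).trans (norm_snd_le p)
  · rw [X_snd_of_eq h, abs_zero]
    exact norm_nonneg p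

/-- A vector is horizontal if and only if it is killed by the contact forms
`du_I - ∑ u_{I + e_i} dx_i`, `|I| < k`. -/
theorem mem_horizontal_iff {p v : JetSpace n k} :
    v ∈ horizontal p ↔ ∀ I : JetIndex n k, ∑ j, I.1 j < k → coeffU p v I = 0 := by
  constructor
  · intro hv I hI
    induction hv using Submodule.span_induction with
    | mem w hw =>
      rcases hw with ⟨i, rfl⟩ | ⟨J, hJ, rfl⟩
      · simp [coeffU, X, Pi.single_apply]
      · have : I ≠ J := by
          rintro rfl
          exact hI.ne hJ
        simp [coeffU, dU, this]
    | zero => simp [coeffU]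
    | add v w _ _ hv hw =>
      have : coeffU p (v + w) I = coeffU p v I + coeffU p w I := by
        simp only [coeffU, Prod.fst_add, Prod.snd_add, Pi.add_apply, add_mul,
          Finset.sum_add_distrib]
        ring
      rw [this, hv, hw, add_zero]
    | smul a w _ hw =>
      have : coeffU p (a • w) I = a * coeffU p w I := by
        simp only [coeffU, Prod.smul_fst, Prod.smul_snd, Pi.smul_apply, smul_eq_mul, mul_assoc,
          ← Finset.mul_sum]
        ring
      rw [this, hw, mul_zero]
  · intro h
    rw [frame_expansion p v]
    refine add_mem (Submodule.sum_mem _ fun i _ => Submodule.smul_mem _ _ ?_)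
      (Submodule.sum_mem _ fun I _ => ?_)
    · exact Submodule.subset_span (Or.inl ⟨i, rfl⟩)
    · rcases lt_or_eq_of_le I.2 with hI | hI
      · rw [h I hI, zero_smul]
        exact zero_mem _
      · exact Submodule.smul_mem _ _ (Submodule.subset_span (Or.inr ⟨I, hI, rfl⟩))

theorem abs_fst_le_sqrt_g0 (p v : JetSpace n k) (i : Fin n) : |v.1 i| ≤ √(g0 p v v) := by
  refine Real.abs_le_sqrt ?_
  have h1 := Finset.single_le_sum (f := fun i => v.1 i * v.1 i) (fun _ _ => mul_self_nonneg _)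
    (Finset.mem_univ i)
  have h2 : 0 ≤ ∑ I, coeffU p v I * coeffU p v I := Finset.sum_nonneg fun _ _ => mul_self_nonneg _
  simp only [g0]
  linarith [sq (v.1 i)]

theorem abs_coeffU_le_sqrt_g0 (p v : JetSpace n k) (I : JetIndex n k) :
    |coeffU p v I| ≤ √(g0 p v v) := by
  refine Real.abs_le_sqrt ?_
  have h1 := Finset.single_le_sum (f := fun I => coeffU p v I * coeffU p v I)
    (fun _ _ => mul_self_nonneg _) (Finset.mem_univ I)
  have h2 : 0 ≤ ∑ i, v.1 i * v.1 i := Finset.sum_nonneg fun _ _ => mul_self_nonneg _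
  simp only [g0]
  linarith [sq (coeffU p v I)]

theorem norm_le_mul_sqrt_g0 (p v : JetSpace n k) : ‖v‖ ≤ (1 + n * ‖p‖) * √(g0 p v v) := by
  have hs := Real.sqrt_nonneg (g0 p v v)
  have hp := norm_nonneg p
  rw [Prod.norm_def, max_le_iff]
  constructor
  · refine (pi_norm_le_iff_of_nonneg (by positivity)).2 fun i => ?_
    have := abs_fst_le_sqrt_g0 p v i
    rw [Real.norm_eq_abs]
    nlinarith [mul_nonneg (mul_nonneg (Nat.cast_nonneg (α := ℝ) n) hp) hs]
  · refine (pi_norm_le_iff_of_nonneg (by positivity)).2 fun I => ?_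
    have h1 : v.2 I = coeffU p v I + ∑ i, v.1 i * (X i p).2 I := by simp [coeffU]
    have h2 : |∑ i, v.1 i * (X i p).2 I| ≤ n * (√(g0 p v v) * ‖p‖) := by
      refine (Finset.abs_sum_le_sum_abs _ _).trans ?_
      refine (Finset.sum_le_card_nsmul _ _ (√(g0 p v v) * ‖p‖) fun i _ => ?_).trans (by simp)
      rw [abs_mul]
      exact mul_le_mul (abs_fst_le_sqrt_g0 p v i) (abs_X_snd_le i p I) (abs_nonneg _) hs
    rw [Real.norm_eq_abs, h1]
    linarith [abs_add_le (coeffU p v I) (∑ i, v.1 i * (X i p).2 I), abs_coeffU_le_sqrt_g0 p v I]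

theorem continuous_X_snd (i : Fin n) (I : JetIndex n k) :
    Continuous fun p : JetSpace n k => (X i p).2 I := by
  rcases lt_or_eq_of_le I.2 with h | h
  · simp only [X_snd_of_lt h]
    fun_prop
  · simp only [X_snd_of_eq h]
    fun_prop

theorem continuous_sqrt_g0 :
    Continuous fun q : JetSpace n k × JetSpace n k => √(g0 q.1 q.2 q.2) := by
  have h : ∀ I : JetIndex n k,
      Continuous fun q : JetSpace n k × JetSpace n k => coeffU q.1 q.2 I := by
    intro I
    have h1 := fun i => (continuous_X_snd (n := n) i I).comp
      (continuous_fst (X := JetSpace n k) (Y := JetSpace n k))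
    simp only [Function.comp_def] at h1
    simp only [coeffU]
    fun_prop
  simp only [g0]
  fun_prop

theorem continuousOn_sqrt_g0 {γ v : ℝ → JetSpace n k} {s : Set ℝ} (hγ : ContinuousOn γ s)
    (hv : ContinuousOn v s) : ContinuousOn (fun t => √(g0 (γ t) (v t) (v t))) s := by
  intro t ht
  have := (continuous_sqrt_g0.continuousAt (x := (γ t, v t))).tendsto.comp
    ((hγ t ht).prodMk_nhds (hv t ht))
  exact this

namespace IsHorizontalCurve

variable {γ : ℝ → JetSpace n k} {p q : JetSpace n k}

theorem continuousOn_velocity (h : IsHorizontalCurve γ p q) :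
    ContinuousOn (velocity γ) (Icc 0 1) :=
  h.contDiffOn.continuousOn_derivWithin (uniqueDiffOn_Icc zero_lt_one) le_rfl

theorem continuousOn_speed (h : IsHorizontalCurve γ p q) :
    ContinuousOn (fun t => √(g0 (γ t) (velocity γ t) (velocity γ t))) (Icc 0 1) :=
  continuousOn_sqrt_g0 h.contDiffOn.continuousOn h.continuousOn_velocity

/-- Along a horizontal curve a linear map varies by at most `C` times the length if it maps every
velocity to a vector of norm at most `C` times the speed. -/
theorem norm_map_sub_le (h : IsHorizontalCurve γ p q) {F : Type*} [NormedAddCommGroup F]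
    [NormedSpace ℝ F] [CompleteSpace F] (ℓ : JetSpace n k →L[ℝ] F) {C : ℝ}
    (hC : ∀ t ∈ Icc (0 : ℝ) 1,
      ‖ℓ (velocity γ t)‖ ≤ C * √(g0 (γ t) (velocity γ t) (velocity γ t)))
    {t : ℝ} (ht : t ∈ Icc (0 : ℝ) 1) : ‖ℓ (γ t) - ℓ p‖ ≤ C * length γ := by
  have hsub : Icc 0 t ⊆ Icc (0 : ℝ) 1 := Icc_subset_Icc_right ht.2
  have hcont : ContinuousOn (fun s => ℓ (velocity γ s)) (Icc 0 1) :=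
    ℓ.continuous.comp_continuousOn h.continuousOn_velocity
  have hftc : ∫ s in (0 : ℝ)..t, ℓ (velocity γ s) = ℓ (γ t) - ℓ (γ 0) := by
    refine intervalIntegral.integral_eq_sub_of_hasDerivAt_of_le ht.1
      (ℓ.continuous.comp_continuousOn (h.contDiffOn.continuousOn.mono hsub)) (fun s hs => ?_)
      ((hcont.mono hsub).intervalIntegrable_of_Icc ht.1)
    have hs' : Icc (0 : ℝ) 1 ∈ nhds s := Icc_mem_nhds hs.1 (hs.2.trans_le ht.2)
    have hd := (h.contDiffOn.differentiableOn one_ne_zero s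
      (hsub (Ioo_subset_Icc_self hs))).hasDerivWithinAt.hasDerivAt hs'
    exact ℓ.hasFDerivAt.comp_hasDerivAt s hd
  have hint : ∀ a ∈ Icc (0 : ℝ) 1, ∀ b ∈ Icc (0 : ℝ) 1, IntervalIntegrable
      (fun s => ‖ℓ (velocity γ s)‖) volume a b := fun a ha b hb =>
    (hcont.norm.mono (uIcc_subset_Icc ha hb)).intervalIntegrable
  have h0 : (0 : ℝ) ∈ Icc (0 : ℝ) 1 := by simp
  have h1 : (1 : ℝ) ∈ Icc (0 : ℝ) 1 := by simp
  rw [← h.source, ← hftc]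
  calc ‖∫ s in (0 : ℝ)..t, ℓ (velocity γ s)‖
      ≤ ∫ s in (0 : ℝ)..t, ‖ℓ (velocity γ s)‖ :=
        intervalIntegral.norm_integral_le_integral_norm ht.1
    _ ≤ ∫ s in (0 : ℝ)..1, ‖ℓ (velocity γ s)‖ := by
        refine intervalIntegral.integral_mono_interval le_rfl ht.1 ht.2
          (Filter.Eventually.of_forall fun _ => norm_nonneg _) (hint 0 h0 1 h1)
    _ ≤ ∫ s in (0 : ℝ)..1, C * √(g0 (γ s) (velocity γ s) (velocity γ s)) :=
        intervalIntegral.integral_mono_on zero_le_one (hint 0 h0 1 h1)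
          ((h.continuousOn_speed.const_mul C).intervalIntegrable_of_Icc zero_le_one) hC
    _ = C * length γ := intervalIntegral.integral_const_mul _ _

/-- A short horizontal curve stays close to its starting point. The velocity is bounded by the
speed times a bound that grows linearly with the position, and for a short curve this bound can be
absorbed. -/
theorem norm_sub_le (h : IsHorizontalCurve γ p q) (hshort : 2 * n * length γ ≤ 1) {t : ℝ}
    (ht : t ∈ Icc (0 : ℝ) 1) : ‖γ t - p‖ ≤ 2 * (1 + n * ‖p‖) * length γ := by
  obtain ⟨t₀, ht₀, hmax⟩ := isCompact_Icc.exists_isMaxOn (nonempty_Icc.2 zero_le_one)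
    (h.contDiffOn.continuousOn.sub continuousOn_const (g := fun _ => p)).norm
  set M := ‖γ t₀ - p‖
  have hM : ∀ s ∈ Icc (0 : ℝ) 1, ‖γ s - p‖ ≤ M := fun s hs => hmax hs
  have key : M ≤ (1 + n * (‖p‖ + M)) * length γ := by
    refine h.norm_map_sub_le (ContinuousLinearMap.id ℝ _) (fun s hs => ?_) ht₀
    refine (norm_le_mul_sqrt_g0 (γ s) (velocity γ s)).trans ?_
    have : ‖γ s‖ ≤ ‖p‖ + M := by
      have := norm_add_le p (γ s - p)
      rw [add_sub_cancel] at this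
      linarith [hM s hs]
    gcongr
  have hM0 : 0 ≤ M := norm_nonneg _
  have := hM t ht
  nlinarith

/-- Taylor estimate along a short horizontal curve: the contact form `du_I - ∑ u_{I + e_i} dx_i`
frozen at the starting point grows only quadratically in the length. -/
theorem abs_contact_le (h : IsHorizontalCurve γ p q) (hshort : 2 * n * length γ ≤ 1)
    {I : JetIndex n k} (hI : ∑ j, I.1 j < k) :
    |(q.2 I - p.2 I) - ∑ i, p.2 (raise I i hI) * (q.1 i - p.1 i)| ≤
      2 * n * (1 + n * ‖p‖) * length γ ^ 2 := by
  let ℓ : JetSpace n k →L[ℝ] ℝ :=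
    (ContinuousLinearMap.proj (R := ℝ) (φ := fun _ => ℝ) I).comp
        (ContinuousLinearMap.snd ℝ (Fin n → ℝ) (JetIndex n k → ℝ)) -
      ∑ i, p.2 (raise I i hI) • (ContinuousLinearMap.proj (R := ℝ) (φ := fun _ => ℝ) i).comp
        (ContinuousLinearMap.fst ℝ (Fin n → ℝ) (JetIndex n k → ℝ))
  have hℓ : ∀ v, ℓ v = v.2 I - ∑ i, p.2 (raise I i hI) * v.1 i := by
    intro v
    simp [ℓ]
  have key := h.norm_map_sub_le ℓ (C := n * (2 * (1 + n * ‖p‖) * length γ)) (fun t ht => ?_)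
    (t := 1) (by simp)
  · rw [h.target, hℓ, hℓ, Real.norm_eq_abs] at key
    refine le_trans (le_of_eq ?_) (key.trans_eq (by ring))
    congr 1
    simp only [mul_sub, Finset.sum_sub_distrib]
    ring
  · have h0 := mem_horizontal_iff.1 (h.horizontal t ht) I hI
    rw [coeffU_of_lt hI, sub_eq_zero] at h0
    have hsum : ℓ (velocity γ t) =
        ∑ i, (velocity γ t).1 i * ((γ t).2 (raise I i hI) - p.2 (raise I i hI)) := by
      rw [hℓ, h0, ← Finset.sum_sub_distrib]
      exact Finset.sum_congr rfl fun i _ => by ring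
    rw [hsum, Real.norm_eq_abs]
    refine (Finset.abs_sum_le_sum_abs _ _).trans ?_
    refine (Finset.sum_le_card_nsmul _ _ (√(g0 (γ t) (velocity γ t) (velocity γ t)) *
      (2 * (1 + n * ‖p‖) * length γ)) fun i _ => ?_).trans_eq ?_
    · rw [abs_mul]
      refine mul_le_mul (abs_fst_le_sqrt_g0 _ _ i) ?_ (abs_nonneg _) (Real.sqrt_nonneg _)
      refine le_trans ?_ (h.norm_sub_le hshort ht)
      exact (norm_le_pi_norm (γ t - p).2 (raise I i hI)).trans (norm_snd_le _)
    · simp only [Finset.card_univ, Fintype.card_fin, nsmul_eq_mul]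
      ring

end IsHorizontalCurve

theorem exists_isHorizontalCurve_of_dc_lt {p q : JetSpace n k} {L : ℝ}
    (h : dc p q < ENNReal.ofReal L) : ∃ γ, IsHorizontalCurve γ p q ∧ length γ < L := by
  simp only [dc, iInf_lt_iff] at h
  obtain ⟨γ, hγ, hl⟩ := h
  exact ⟨γ, hγ, (ENNReal.ofReal_lt_ofReal_iff_of_nonneg (intervalIntegral.integral_nonneg
    zero_le_one fun _ _ => Real.sqrt_nonneg _)).1 hl⟩

end JetSpace

/-! ### Lipschitz maps into jet space -/

namespace JetSpace

variable {n k : ℕ}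

/-- `g` maps any two points of `s` to points joined by a horizontal curve of length at most `K` times
their distance. -/
def ConnectsOn {E : Type*} [NormedAddCommGroup E] (K : ℝ) (g : E → JetSpace n k) (s : Set E) :
    Prop :=
  ∀ z ∈ s, ∀ w ∈ s, z ≠ w →
    ∃ γ, IsHorizontalCurve γ (g z) (g w) ∧ length γ ≤ K * ‖w - z‖

namespace ConnectsOn

variable {E : Type*} [NormedAddCommGroup E] {K : ℝ} {g : E → JetSpace n k} {s : Set E}

theorem short (hK : 0 < K) {z w : E} (h : ‖w - z‖ ≤ (2 * (n + 1) * K)⁻¹) {L : ℝ}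
    (hL : L ≤ K * ‖w - z‖) : 2 * n * L ≤ 1 := by
  have h1 : ‖w - z‖ * (2 * (n + 1) * K) ≤ 1 := by
    rwa [← le_div_iff₀ (by positivity), one_div]
  have h2 : 2 * n * L ≤ 2 * n * (K * ‖w - z‖) := by gcongr
  nlinarith [mul_nonneg hK.le (norm_nonneg (w - z))]

theorem norm_sub_le (hg : ConnectsOn K g s) (hK : 0 < K) {z w : E} (hz : z ∈ s) (hw : w ∈ s)
    (h : ‖w - z‖ ≤ (2 * (n + 1) * K)⁻¹) :
    ‖g w - g z‖ ≤ 2 * (1 + n * ‖g z‖) * K * ‖w - z‖ := by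
  rcases eq_or_ne z w with rfl | hne
  · simp
  obtain ⟨γ, hγ, hl⟩ := hg z hz w hw hne
  have := hγ.norm_sub_le (short hK h hl) (t := 1) (by simp)
  rw [hγ.target] at this
  refine this.trans ?_
  rw [mul_assoc _ K]
  gcongr

theorem lipschitzOnWith (hg : ConnectsOn K g s) (hK : 0 < K) (hs : IsCompact s) :
    ∃ C, LipschitzOnWith C g s := by
  set δ : ℝ := (2 * (n + 1) * K)⁻¹
  have hδ : 0 < δ := by positivity
  have hcont : ContinuousOn g s := by
    intro z hz
    rw [ContinuousWithinAt, tendsto_iff_norm_sub_tendsto_zero]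
    refine squeeze_zero' (g := fun w => 2 * (1 + n * ‖g z‖) * K * ‖w - z‖)
      (Filter.Eventually.of_forall fun _ => norm_nonneg _) ?_ ?_
    · filter_upwards [self_mem_nhdsWithin, mem_nhdsWithin_of_mem_nhds (closedBall_mem_nhds z hδ)]
        with w hw hwδ
      exact hg.norm_sub_le hK hz hw (by rwa [mem_closedBall, dist_eq_norm] at hwδ)
    · have : Continuous fun w => 2 * (1 + n * ‖g z‖) * K * ‖w - z‖ := by fun_prop
      simpa using (this.tendsto z).mono_left nhdsWithin_le_nhds
  obtain ⟨B, hB⟩ := hs.exists_bound_of_continuousOn hcont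
  refine ⟨(max (2 * (1 + n * B) * K) (2 * B / δ)).toNNReal,
    LipschitzOnWith.of_dist_le_mul fun w hw z hz => ?_⟩
  have hB0 : 0 ≤ B := (norm_nonneg _).trans (hB z hz)
  rw [Real.coe_toNNReal _ (le_max_of_le_left (by positivity)), dist_eq_norm, dist_eq_norm]
  rcases le_or_gt ‖w - z‖ δ with h | h
  · refine (hg.norm_sub_le hK hz hw h).trans ?_
    refine mul_le_mul_of_nonneg_right (le_max_of_le_left ?_) (norm_nonneg _)
    have := hB z hz
    gcongr
  · calc ‖g w - g z‖ ≤ ‖g w‖ + ‖g z‖ := _root_.norm_sub_le _ _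
      _ ≤ 2 * B := by linarith [hB z hz, hB w hw]
      _ = 2 * B / δ * δ := by field_simp
      _ ≤ max (2 * (1 + n * B) * K) (2 * B / δ) * ‖w - z‖ := by
        have := le_max_right (2 * (1 + n * B) * K) (2 * B / δ)
        gcongr

/-- The contact form `du_I - ∑ u_{I + e_i} dx_i`, frozen at `g z`, has zero derivative along `g` at
`z`, even where `g` itself is not differentiable. -/
theorem hasFDerivAt_contact [NormedSpace ℝ E] (hg : ConnectsOn K g s) (hK : 0 < K) {z : E}
    (hz : s ∈ nhds z) {I : JetIndex n k} (hI : ∑ j, I.1 j < k) :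
    HasFDerivAt (fun w => ((g w).2 I - (g z).2 I) -
      ∑ i, (g z).2 (raise I i hI) * ((g w).1 i - (g z).1 i)) (0 : E →L[ℝ] ℝ) z := by
  refine Asymptotics.IsBigO.hasFDerivAt (n := 2) ?_ one_lt_two
  refine Asymptotics.IsBigO.of_bound (2 * n * (1 + n * ‖g z‖) * K ^ 2) ?_
  have hδ : (0 : ℝ) < (2 * (n + 1) * K)⁻¹ := by positivity
  filter_upwards [hz, closedBall_mem_nhds z hδ] with w hw hwδ
  rcases eq_or_ne z w with rfl | hne
  · simp
  obtain ⟨γ, hγ, hl⟩ := hg z (mem_of_mem_nhds hz) w hw hne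
  refine (hγ.abs_contact_le (short hK (by rwa [mem_closedBall, dist_eq_norm] at hwδ) hl) hI).trans ?_
  rw [norm_pow, norm_norm, mul_assoc _ (K ^ 2), ← mul_pow]
  have h0 : 0 ≤ length γ := intervalIntegral.integral_nonneg zero_le_one
    fun _ _ => Real.sqrt_nonneg _
  gcongr

end ConnectsOn

/-- The projection `J^k(ℝⁿ) → ℝⁿ⁺¹`, `(x, u) ↦ (u₀, x)`. -/
noncomputable def toGraph (n k : ℕ) : JetSpace n k →L[ℝ] EuclideanSpace ℝ (Fin (n + 1)) :=
  ((EuclideanSpace.equiv (Fin (n + 1)) ℝ).symm : (Fin (n + 1) → ℝ) →L[ℝ] _).comp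
    (ContinuousLinearMap.pi (Fin.cons
      ((ContinuousLinearMap.proj (R := ℝ) (φ := fun _ : JetIndex n k => ℝ) ⟨0, by simp⟩).comp
        (ContinuousLinearMap.snd ℝ (Fin n → ℝ) (JetIndex n k → ℝ)))
      fun i => (ContinuousLinearMap.proj (R := ℝ) (φ := fun _ : Fin n => ℝ) i).comp
        (ContinuousLinearMap.fst ℝ (Fin n → ℝ) (JetIndex n k → ℝ))))

theorem toGraph_zero (p : JetSpace n k) : toGraph n k p 0 = p.2 ⟨0, by simp⟩ := rfl

theorem toGraph_succ (p : JetSpace n k) (i : Fin n) : toGraph n k p i.succ = p.1 i := rfl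

/-- Because `du₀ = ∑ u_{e_i} dx_i` along `g`, the map `(u₀, x) ∘ g` has rank at most `n`. -/
theorem ConnectsOn.det_fderiv_toGraph_eq_zero {K : ℝ} (hk : 1 ≤ k)
    {g : EuclideanSpace ℝ (Fin (n + 1)) → JetSpace n k}
    {s : Set (EuclideanSpace ℝ (Fin (n + 1)))} (hg : ConnectsOn K g s) (hK : 0 < K)
    {z : EuclideanSpace ℝ (Fin (n + 1))} (hz : s ∈ nhds z)
    (hd : DifferentiableAt ℝ (fun w => toGraph n k (g w)) z) :
    (fderiv ℝ (fun w => toGraph n k (g w)) z).det = 0 := by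
  let I₀ : JetIndex n k := ⟨0, by simp⟩
  have hI₀ : ∑ j, I₀.1 j < k := by simpa [I₀] using Nat.pos_of_ne_zero (by lia)
  -- The contact form frozen at `g z`, a nonzero functional that kills the range of the derivative.
  let m : EuclideanSpace ℝ (Fin (n + 1)) →L[ℝ] ℝ :=
    EuclideanSpace.proj 0 - ∑ i : Fin n, (g z).2 (raise I₀ i hI₀) • EuclideanSpace.proj i.succ
  have hm : ∀ v, m v = v 0 - ∑ i : Fin n, (g z).2 (raise I₀ i hI₀) * v i.succ := by
    intro v
    simp [m]
  have h1 : HasFDerivAt (fun w => m (toGraph n k (g w) - toGraph n k (g z)))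
      (m.comp (fderiv ℝ (fun w => toGraph n k (g w)) z)) z :=
    m.hasFDerivAt.comp z (hd.hasFDerivAt.sub_const _)
  have h2 : HasFDerivAt (fun w => m (toGraph n k (g w) - toGraph n k (g z)))
      (0 : EuclideanSpace ℝ (Fin (n + 1)) →L[ℝ] ℝ) z := by
    have h := hg.hasFDerivAt_contact hK hz hI₀
    refine h.congr_of_eventuallyEq (Filter.Eventually.of_forall fun w => ?_)
    refine (hm _).trans ?_
    simp only [PiLp.sub_apply, toGraph_zero, toGraph_succ]
    rfl
  have h3 := h1.unique h2
  by_contra hdet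
  have hsurj : Function.Surjective (fderiv ℝ (fun w => toGraph n k (g w)) z) :=
    (LinearMap.equivOfDetNeZero
      (fderiv ℝ (fun w => toGraph n k (g w)) z).toLinearMap hdet).surjective
  obtain ⟨v, hv⟩ := hsurj (EuclideanSpace.single 0 1)
  have h4 := DFunLike.congr_fun h3 v
  rw [ContinuousLinearMap.comp_apply, hv, hm] at h4
  simp at h4

end JetSpace

/-! ### Arcs of great circles -/

section GreatCircle

variable {E : Type*} [NormedAddCommGroup E] [InnerProductSpace ℝ E]

theorem norm_add_smul_of_orthonormal {x w : E} (hx : ‖x‖ = 1) (hw : ‖w‖ = 1)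
    (hxw : inner ℝ x w = 0) (a b : ℝ) : ‖a • x + b • w‖ = √(a ^ 2 + b ^ 2) := by
  rw [← Real.sqrt_sq (norm_nonneg (a • x + b • w)), @norm_add_sq_real]
  simp [norm_smul, hx, hw, inner_smul_left, inner_smul_right, hxw]

/-- Two points of the unit sphere are joined by an arc of a great circle, whose speed is constant and
comparable to the chordal distance. -/
theorem exists_greatCircle_arc (hdim : 1 < Module.finrank ℝ E) {x y : E} (hx : ‖x‖ = 1)
    (hy : ‖y‖ = 1) : ∃ (c : ℝ → E), ContDiff ℝ 1 c ∧ c 0 = x ∧ c 1 = y ∧ (∀ t, ‖c t‖ = 1) ∧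
      ∀ t, ‖deriv c t‖ ≤ 2 * ‖x - y‖ := by
  have : FiniteDimensional ℝ E := Module.finite_of_finrank_pos (by lia)
  set a : ℝ := inner ℝ x y
  set u : E := y - a • x
  have hxx : inner ℝ x x = (1 : ℝ) := by simp [hx]
  have hxu : inner ℝ x u = (0 : ℝ) := by
    simp [u, inner_sub_right, inner_smul_right, hx, a]
  obtain ⟨w, hw, hxw, hu⟩ : ∃ w : E, ‖w‖ = 1 ∧ inner ℝ x w = (0 : ℝ) ∧ u = ‖u‖ • w := by
    rcases eq_or_ne u 0 with h0 | h0
    · have hne : x ≠ 0 := by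
        rintro rfl
        simp at hx
      have : Nontrivial (ℝ ∙ x)ᗮ := by
        apply Module.nontrivial_of_finrank_pos (R := ℝ)
        have h1 := Submodule.finrank_add_finrank_orthogonal (ℝ ∙ x)
        rw [finrank_span_singleton hne] at h1
        lia
      obtain ⟨w, hw⟩ := exists_norm_eq (E := (ℝ ∙ x)ᗮ) zero_le_one
      exact ⟨w, hw, Submodule.mem_orthogonal_singleton_iff_inner_right.1 w.2, by simp [h0]⟩
    · refine ⟨‖u‖⁻¹ • u, norm_smul_inv_norm (𝕜 := ℝ) h0, ?_, ?_⟩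
      · rw [inner_smul_right, hxu, mul_zero]
      · rw [smul_inv_smul₀ (norm_ne_zero_iff.2 h0)]
  have hyu : y = a • x + ‖u‖ • w := by
    rw [← hu]
    simp [u]
  have hau : a ^ 2 + ‖u‖ ^ 2 = 1 := by
    have h1 := norm_add_smul_of_orthonormal hx hw hxw a ‖u‖
    rw [← hyu, hy] at h1
    exact (Real.sqrt_eq_one.1 h1.symm)
  have ha1 : -1 ≤ a := by nlinarith [sq_nonneg ‖u‖]
  have ha2 : a ≤ 1 := by nlinarith [sq_nonneg ‖u‖]
  set α := Real.arccos a
  have hcos : Real.cos α = a := Real.cos_arccos ha1 ha2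
  have hsin : Real.sin α = ‖u‖ := by
    rw [Real.sin_arccos, ← Real.sqrt_sq (norm_nonneg u)]
    congr 1
    linarith
  have hα0 : 0 ≤ α := Real.arccos_nonneg a
  have hbound : α ≤ 2 * ‖x - y‖ := by
    have hxy : ‖x - y‖ ^ 2 = 2 - 2 * a := by
      rw [@norm_sub_sq_real, hx, hy]
      ring
    have h1 := Real.cos_le_one_sub_mul_cos_sq (x := α)
      (by rw [abs_of_nonneg hα0]; exact Real.arccos_le_pi a)
    rw [hcos] at h1
    have h2 : (1 : ℝ) / 8 ≤ 2 / Real.pi ^ 2 := by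
      rw [div_le_div_iff₀ (by norm_num) (by positivity)]
      nlinarith [Real.pi_le_four, Real.pi_pos]
    refine abs_le_of_sq_le_sq' ?_ (by positivity) |>.2
    rw [mul_pow, hxy]
    nlinarith [mul_le_mul_of_nonneg_right h2 (sq_nonneg α)]
  refine ⟨fun t => Real.cos (α * t) • x + Real.sin (α * t) • w, by fun_prop, by simp, ?_,
    fun t => ?_, fun t => ?_⟩
  · simp only [mul_one]
    rw [hcos, hsin, ← hyu]
  · rw [norm_add_smul_of_orthonormal hx hw hxw]
    simp
  · have hlin : HasDerivAt (fun s : ℝ => α * s) α t := by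
      simpa using (hasDerivAt_id t).const_mul α
    have hd := (hlin.cos.smul_const x).add (hlin.sin.smul_const w)
    have hd' : deriv (fun s => Real.cos (α * s) • x + Real.sin (α * s) • w) t =
        (-Real.sin (α * t) * α) • x + (Real.cos (α * t) * α) • w := hd.deriv
    rw [hd', norm_add_smul_of_orthonormal hx hw hxw]
    refine le_trans (Real.sqrt_le_iff.2 ⟨hα0, le_of_eq ?_⟩) hbound
    linear_combination α ^ 2 * Real.sin_sq_add_cos_sq (α * t)

end GreatCircle

/-! ### A horizontal map on the sphere -/

namespace JetSpace

variable {n k : ℕ}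

theorem g0_smul_smul (a : ℝ) (p v : JetSpace n k) : g0 p (a • v) (a • v) = a ^ 2 * g0 p v v := by
  have h : ∀ I, coeffU p (a • v) I = a * coeffU p v I := by
    intro I
    simp only [coeffU, Prod.smul_fst, Prod.smul_snd, Pi.smul_apply, smul_eq_mul, mul_assoc,
      ← Finset.mul_sum]
    ring
  simp only [g0, h, Prod.smul_fst, Pi.smul_apply, smul_eq_mul, mul_add, Finset.mul_sum]
  congr 1 <;> exact Finset.sum_congr rfl fun _ _ => by ring

/-- A smooth map that is horizontal along the unit sphere is Lipschitz on the sphere for the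
Carnot–Carathéodory distance: it maps arcs of great circles to horizontal curves. -/
theorem isLipschitz_restrict_sphere {E : Type*} [NormedAddCommGroup E] [InnerProductSpace ℝ E]
    (hdim : 1 < Module.finrank ℝ E) {f : E → JetSpace n k} (hf : ContDiff ℝ 1 f)
    (hhor : ∀ z ∈ sphere (0 : E) 1, ∀ v, fderiv ℝ f z v ∈ horizontal (f z)) :
    IsLipschitz fun z : sphere (0 : E) 1 => f z := by
  have : FiniteDimensional ℝ E := Module.finite_of_finrank_pos (by lia)
  have hcont : Continuous fun q : E × E =>
      √(g0 (f q.1) (fderiv ℝ f q.1 q.2) (fderiv ℝ f q.1 q.2)) := by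
    have h1 : Continuous fun q : E × E => (f q.1, fderiv ℝ f q.1 q.2) :=
      (hf.continuous.comp continuous_fst).prodMk (hf.continuous_fderiv_apply one_ne_zero)
    exact continuous_sqrt_g0.comp h1
  obtain ⟨C, hC⟩ := ((isCompact_sphere (0 : E) 1).prod
    (isCompact_sphere (0 : E) 1)).exists_bound_of_continuousOn hcont.continuousOn
  have hspeed : ∀ z ∈ sphere (0 : E) 1, ∀ v,
      √(g0 (f z) (fderiv ℝ f z v) (fderiv ℝ f z v)) ≤ max C 0 * ‖v‖ := by
    intro z hz v
    rcases eq_or_ne v 0 with rfl | hv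
    · simp [g0, coeffU]
    · have h1 := hC (z, ‖v‖⁻¹ • v) ⟨hz, by simpa using norm_smul_inv_norm (𝕜 := ℝ) hv⟩
      have h2 : fderiv ℝ f z v = ‖v‖ • fderiv ℝ f z (‖v‖⁻¹ • v) := by
        rw [← map_smul, smul_inv_smul₀ (norm_ne_zero_iff.2 hv)]
      rw [h2, g0_smul_smul, Real.sqrt_mul (sq_nonneg _), Real.sqrt_sq (norm_nonneg v), mul_comm]
      exact mul_le_mul_of_nonneg_right (((le_abs_self _).trans h1).trans (le_max_left _ _))
        (norm_nonneg v)
  refine ⟨(max C 0 * 2).toNNReal, fun x y => ?_⟩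
  obtain ⟨c, hc, hc0, hc1, hcS, hcv⟩ := exists_greatCircle_arc hdim
    (mem_sphere_zero_iff_norm.1 x.2) (mem_sphere_zero_iff_norm.1 y.2)
  have hcS' : ∀ t, c t ∈ sphere (0 : E) 1 := fun t => mem_sphere_zero_iff_norm.2 (hcS t)
  have hvel : ∀ t ∈ Icc (0 : ℝ) 1, velocity (f ∘ c) t = fderiv ℝ f (c t) (deriv c t) := by
    intro t ht
    have h1 := (hf.differentiable one_ne_zero (c t)).hasFDerivAt.comp_hasDerivAt t
      (hc.differentiable one_ne_zero t).hasDerivAt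
    exact h1.hasDerivWithinAt.derivWithin (uniqueDiffOn_Icc zero_lt_one t ht)
  have hcurve : IsHorizontalCurve (f ∘ c) (f x) (f y) :=
    { contDiffOn := (hf.comp hc).contDiffOn
      source := by simp [hc0]
      target := by simp [hc1]
      horizontal := fun t ht => by
        rw [hvel t ht]
        exact hhor _ (hcS' t) _ }
  have hlen : length (f ∘ c) ≤ max C 0 * 2 * dist x y := by
    have h1 : length (f ∘ c) ≤ ∫ _ in (0 : ℝ)..1, max C 0 * 2 * dist x y := by
      refine intervalIntegral.integral_mono_on zero_le_one
        (hcurve.continuousOn_speed.intervalIntegrable_of_Icc zero_le_one)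
        (continuous_const.intervalIntegrable _ _) fun t ht => ?_
      rw [hvel t ht, mul_assoc, Subtype.dist_eq, dist_eq_norm]
      exact (hspeed _ (hcS' t) _).trans
        (mul_le_mul_of_nonneg_left (hcv t) (le_max_right _ _))
    simpa using h1
  calc dc (f x) (f y) ≤ ENNReal.ofReal (length (f ∘ c)) := iInf₂_le
        (f := fun γ (_ : IsHorizontalCurve γ (f x) (f y)) => ENNReal.ofReal (length γ)) _ hcurve
    _ ≤ ENNReal.ofReal (max C 0 * 2 * dist x y) := ENNReal.ofReal_le_ofReal hlen
    _ = (max C 0 * 2).toNNReal * edist x y := by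
      rw [ENNReal.ofReal_mul (by positivity), edist_dist]
      rfl

/-- The map `z ↦ (x, (θ(z₀) ∂_I φ(x))_I)` with `x = (z₁, …, zₙ)` and `φ(x) = β(x₁) ⋯ β(xₙ)`. Where
`θ` is locally constant this is the `k`-jet at `x` of a constant multiple of `φ`. -/
noncomputable def bumpJet (n k : ℕ) (θ β : ℝ → ℝ) (z : EuclideanSpace ℝ (Fin (n + 1))) :
    JetSpace n k :=
  (fun i => z i.succ, fun I => θ (z 0) * ∏ i, iteratedDeriv (I.1 i) β (z i.succ))

section BumpJet

variable {θ β : ℝ → ℝ}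

theorem contDiff_bumpJet (hθ : ContDiff ℝ (⊤ : ℕ∞) θ) (hβ : ContDiff ℝ (⊤ : ℕ∞) β) :
    ContDiff ℝ 1 (bumpJet n k θ β) := by
  have h1 : ∀ m, ContDiff ℝ 1 (iteratedDeriv m β) := fun m => by
    rw [iteratedDeriv_eq_iterate]
    exact (hβ.iterate_deriv m).of_le (by simp)
  have h2 : ContDiff ℝ 1 θ := hθ.of_le (by simp)
  have h3 : ∀ i : Fin (n + 1), ContDiff ℝ 1 fun z : EuclideanSpace ℝ (Fin (n + 1)) => z i :=
    fun i => (EuclideanSpace.proj i : EuclideanSpace ℝ (Fin (n + 1)) →L[ℝ] ℝ).contDiff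
  refine ContDiff.prodMk (contDiff_pi.2 fun i => h3 _) (contDiff_pi.2 fun I => ?_)
  exact (h2.comp (h3 0)).mul (contDiff_prod fun i _ => (h1 _).comp (h3 _))

theorem fderiv_bumpJet_fst (hθ : ContDiff ℝ (⊤ : ℕ∞) θ) (hβ : ContDiff ℝ (⊤ : ℕ∞) β)
    (z v : EuclideanSpace ℝ (Fin (n + 1))) (i : Fin n) :
    (fderiv ℝ (bumpJet n k θ β) z v).1 i = v i.succ := by
  have h1 := ((contDiff_bumpJet (n := n) (k := k) hθ hβ).differentiable one_ne_zero z).hasFDerivAt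
  have h2 := (hasFDerivAt_pi'.1 h1.fst) i
  have h3 := (EuclideanSpace.proj i.succ : EuclideanSpace ℝ (Fin (n + 1)) →L[ℝ] ℝ).hasFDerivAt (x := z)
  exact DFunLike.congr_fun (h2.unique h3) v

theorem fderiv_bumpJet_snd (hθ : ContDiff ℝ (⊤ : ℕ∞) θ) (hβ : ContDiff ℝ (⊤ : ℕ∞) β)
    (z v : EuclideanSpace ℝ (Fin (n + 1))) (I : JetIndex n k) :
    (fderiv ℝ (bumpJet n k θ β) z v).2 I =
      deriv θ (z 0) * v 0 * ∏ i, iteratedDeriv (I.1 i) β (z i.succ) +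
      ∑ i, v i.succ * (θ (z 0) *
        ∏ j, iteratedDeriv ((I.1 + Pi.single i 1 : Fin n → ℕ) j) β (z j.succ)) := by
  have h1 := ((contDiff_bumpJet (n := n) (k := k) hθ hβ).differentiable one_ne_zero z).hasFDerivAt
  have h2 := (hasFDerivAt_pi'.1 h1.snd) I
  have hline : HasDerivAt (fun s : ℝ => z + s • v) v 0 := by
    simpa using ((hasDerivAt_id (0 : ℝ)).smul_const v).const_add z
  have hcoord : ∀ j, HasDerivAt (fun s : ℝ => (z + s • v) j) (v j) 0 := fun j =>
    (EuclideanSpace.proj j : EuclideanSpace ℝ (Fin (n + 1)) →L[ℝ] ℝ).hasFDerivAt.comp_hasDerivAt 0 hline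
  have hz : z = z + (0 : ℝ) • v := by simp
  have h3 : HasDerivAt (fun s : ℝ => (bumpJet n k θ β (z + s • v)).2 I)
      ((fderiv ℝ (bumpJet n k θ β) z v).2 I) 0 := by
    rw [hz] at h2
    have := h2.comp_hasDerivAt (0 : ℝ) hline
    rwa [← hz] at this
  have hiter : ∀ m t, HasDerivAt (iteratedDeriv m β) (iteratedDeriv (m + 1) β t) t := by
    intro m t
    rw [iteratedDeriv_succ]
    exact (hβ.differentiable_iteratedDeriv m (by exact_mod_cast ENat.natCast_lt_top m) t).hasDerivAt
  have h4 : HasDerivAt (fun s : ℝ => θ ((z + s • v) 0)) (deriv θ (z 0) * v 0) 0 := by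
    have h5 := (hθ.differentiable (by simp) ((z + (0 : ℝ) • v) 0)).hasDerivAt.comp
      (h := fun s : ℝ => (z + s • v) 0) (0 : ℝ) (hcoord 0)
    rwa [← hz] at h5
  have h6 : HasDerivAt (fun s : ℝ => ∏ i, iteratedDeriv (I.1 i) β ((z + s • v) (Fin.succ i)))
      (∑ i, (∏ j ∈ Finset.univ.erase i, iteratedDeriv (I.1 j) β (z (Fin.succ j))) •
        (iteratedDeriv (I.1 i + 1) β (z (Fin.succ i)) * v (Fin.succ i))) 0 := by
    have h7 := HasDerivAt.fun_finsetProd (u := Finset.univ)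
      (f := fun (i : Fin n) (s : ℝ) => iteratedDeriv (I.1 i) β ((z + s • v) (Fin.succ i)))
      (f' := fun i => iteratedDeriv (I.1 i + 1) β (z (Fin.succ i)) * v (Fin.succ i)) (x := 0)
      (fun i _ => by
        have := (hiter (I.1 i) ((z + (0 : ℝ) • v) (Fin.succ i))).comp 0 (hcoord i.succ)
        rwa [← hz] at this)
    rwa [← hz] at h7
  have h8 := h4.mul h6
  rw [← hz] at h8
  rw [h3.unique h8, Finset.mul_sum]
  congr 1
  refine Finset.sum_congr rfl fun i _ => ?_
  have herase : ∏ j ∈ Finset.univ.erase i, iteratedDeriv (I.1 j) β (z (Fin.succ j)) =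
      ∏ j ∈ Finset.univ.erase i,
        iteratedDeriv ((I.1 + Pi.single i 1 : Fin n → ℕ) j) β (z (Fin.succ j)) := by
    refine Finset.prod_congr rfl fun j hj => ?_
    simp [Pi.single_eq_of_ne (Finset.ne_of_mem_erase hj)]
  rw [← Finset.mul_prod_erase Finset.univ _ (Finset.mem_univ i), herase]
  simp
  ring

theorem fderiv_bumpJet_mem_horizontal (hθ : ContDiff ℝ (⊤ : ℕ∞) θ) (hβ : ContDiff ℝ (⊤ : ℕ∞) β)
    {z : EuclideanSpace ℝ (Fin (n + 1))}
    (hz : ∀ I : JetIndex n k, deriv θ (z 0) * ∏ i, iteratedDeriv (I.1 i) β (z i.succ) = 0)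
    (v : EuclideanSpace ℝ (Fin (n + 1))) :
    fderiv ℝ (bumpJet n k θ β) z v ∈ horizontal (bumpJet n k θ β z) := by
  refine mem_horizontal_iff.2 fun I hI => ?_
  rw [coeffU_of_lt hI, fderiv_bumpJet_snd hθ hβ, mul_right_comm, hz, zero_mul, zero_add, sub_eq_zero]
  simp only [fderiv_bumpJet_fst hθ hβ]
  rfl

/-- In the coordinates `(u₀, x)` the map `bumpJet` is `(z₀, x) ↦ (θ(z₀) φ(x), x)`. -/
theorem det_fderiv_toGraph_bumpJet (hθ : ContDiff ℝ (⊤ : ℕ∞) θ) (hβ : ContDiff ℝ (⊤ : ℕ∞) β)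
    (z : EuclideanSpace ℝ (Fin (n + 1))) :
    (fderiv ℝ (fun w => toGraph n k (bumpJet n k θ β w)) z).det =
      deriv θ (z 0) * ∏ i : Fin n, β (z i.succ) := by
  let I₀ : JetIndex n k := ⟨0, by simp⟩
  have h1 := ((contDiff_bumpJet (n := n) (k := k) hθ hβ).differentiable one_ne_zero z).hasFDerivAt
  have h2 := ((toGraph n k).hasFDerivAt.comp z h1).fderiv
  let m : EuclideanSpace ℝ (Fin (n + 1)) →ₗ[ℝ] ℝ :=
    LinearMap.proj I₀ ∘ₗ LinearMap.snd ℝ (Fin n → ℝ) (JetIndex n k → ℝ) ∘ₗ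
      (fderiv ℝ (bumpJet n k θ β) z).toLinearMap -
      (EuclideanSpace.proj (0 : Fin (n + 1)) : EuclideanSpace ℝ (Fin (n + 1)) →L[ℝ] ℝ).toLinearMap
  have hm : ∀ v, m v = (fderiv ℝ (bumpJet n k θ β) z v).2 I₀ - v 0 := fun v => rfl
  -- The derivative is the identity up to the coordinate `z₀`, so it has the form `1 + m ⊗ e₀`.
  have h3 : ((toGraph n k).comp (fderiv ℝ (bumpJet n k θ β) z)).toLinearMap =
      LinearMap.transvection m (EuclideanSpace.single 0 1) := by
    ext v j
    refine Fin.cases ?_ (fun i => ?_) j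
    · simp [LinearMap.transvection.apply, hm, toGraph_zero, I₀]
    · simp [LinearMap.transvection.apply, toGraph_succ, fderiv_bumpJet_fst hθ hβ]
  change (fderiv ℝ (toGraph n k ∘ bumpJet n k θ β) z).det = _
  rw [h2, ContinuousLinearMap.det, h3, LinearMap.transvection.det, hm,
    fderiv_bumpJet_snd hθ hβ]
  simp [I₀]

end BumpJet

end JetSpace

/-! ### Non-extension -/

theorem iteratedDeriv_eq_zero_of_notMem_tsupport {f : ℝ → ℝ} {t : ℝ} (ht : t ∉ tsupport f)
    (m : ℕ) : iteratedDeriv m f t = 0 := by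
  rw [Filter.EventuallyEq.iteratedDeriv_eq m (notMem_tsupport_iff_eventuallyEq.1 ht)]
  simp

theorem exists_contDiff_deriv_eq {β : ℝ → ℝ} (hβ : ContDiff ℝ (⊤ : ℕ∞) β) :
    ∃ θ : ℝ → ℝ, ContDiff ℝ (⊤ : ℕ∞) θ ∧ ∀ t, deriv θ t = β t := by
  have h : ∀ t, HasDerivAt (fun t => ∫ s in (0 : ℝ)..t, β s) (β t) t := fun t =>
    intervalIntegral.integral_hasDerivAt_right (hβ.continuous.intervalIntegrable _ _)
      (hβ.continuous.stronglyMeasurableAtFilter _ _) hβ.continuous.continuousAt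
  refine ⟨_, contDiff_infty_iff_deriv.2 ⟨fun t => (h t).differentiableAt, ?_⟩, fun t => (h t).deriv⟩
  rwa [funext fun t => (h t).deriv]

/-- Some coordinate of a unit vector in `ℝᵐ` is larger than `1 / (2m)`. -/
theorem exists_lt_abs_of_mem_sphere {m : ℕ} (z : EuclideanSpace ℝ (Fin m)) (hz : ‖z‖ = 1) :
    ∃ i, 1 / (2 * m : ℝ) < |z i| := by
  by_contra! h
  have hm : (0 : ℝ) < m := by
    rcases Nat.eq_zero_or_pos m with rfl | hm
    · simp [EuclideanSpace.norm_eq] at hz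
    · exact_mod_cast hm
  have h1 : ‖z‖ ^ 2 ≤ m * (1 / (2 * m : ℝ)) ^ 2 := by
    rw [EuclideanSpace.norm_sq_eq]
    refine (Finset.sum_le_card_nsmul _ _ ((1 / (2 * m : ℝ)) ^ 2) fun i _ => ?_).trans (by simp)
    rw [Real.norm_eq_abs]
    exact pow_le_pow_left₀ (abs_nonneg _) (h i) 2
  have h2 : (m : ℝ) * (1 / (2 * m : ℝ)) ^ 2 = 1 / (4 * m) := by
    field_simp
    norm_num
  have h3 : (1 : ℝ) ≤ m := by exact_mod_cast (by exact_mod_cast hm : 0 < m)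
  rw [hz, h2, one_pow, le_div_iff₀ (by positivity)] at h1
  linarith

namespace JetSpace

theorem IsLipschitz.exists_connectsOn {n k : ℕ} {E : Type*} [NormedAddCommGroup E] {s : Set E}
    {g : E → JetSpace n k} (hg : IsLipschitz fun z : s => g z) : ∃ K > 0, ConnectsOn K g s := by
  obtain ⟨K, hK⟩ := hg
  refine ⟨K + 1, by positivity, fun z hz w hw hne => ?_⟩
  have hpos : 0 < ‖w - z‖ := norm_pos_iff.2 (sub_ne_zero.2 hne.symm)
  have h1 : dc (g z) (g w) < ENNReal.ofReal ((K + 1) * ‖w - z‖) := by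
    refine (hK ⟨z, hz⟩ ⟨w, hw⟩).trans_lt ?_
    rw [edist_dist, Subtype.dist_eq, dist_comm, dist_eq_norm, ← ENNReal.ofReal_coe_nnreal,
      ← ENNReal.ofReal_mul K.coe_nonneg]
    exact (ENNReal.ofReal_lt_ofReal_iff (by positivity)).2 (by nlinarith [K.2])
  obtain ⟨γ, hγ, hl⟩ := exists_isHorizontalCurve_of_dc_lt h1
  exact ⟨γ, hγ, hl.le⟩

/-- A map on the closed ball is not Lipschitz if it agrees on the sphere with a smooth map `F` whose
projection to `(u₀, x)` has nonzero total Jacobian over the ball. -/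
theorem not_isLipschitz_of_integral_det_ne_zero {n k : ℕ} (hk : 1 ≤ k)
    {F : EuclideanSpace ℝ (Fin (n + 1)) → JetSpace n k} (hF : ContDiff ℝ 1 F)
    (hint : ∫ z in ball (0 : EuclideanSpace ℝ (Fin (n + 1))) 1,
      (fderiv ℝ (fun w => toGraph n k (F w)) z).det ≠ 0)
    {g : EuclideanSpace ℝ (Fin (n + 1)) → JetSpace n k}
    (hgF : ∀ z ∈ sphere (0 : EuclideanSpace ℝ (Fin (n + 1))) 1, g z = F z) :
    ¬ IsLipschitz fun z : closedBall (0 : EuclideanSpace ℝ (Fin (n + 1))) 1 => g z := by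
  intro hg
  obtain ⟨K, hK, hconn⟩ := hg.exists_connectsOn
  obtain ⟨C, hC⟩ := hconn.lipschitzOnWith hK (isCompact_closedBall _ _)
  refine hint (setIntegral_det_fderiv_eq_zero volume ((toGraph n k).contDiff.comp hF)
    ((toGraph n k).lipschitz.comp_lipschitzOnWith hC)
    (fun z hz => congrArg (toGraph n k) (hgF z hz)) fun z hz hd => ?_)
  exact hconn.det_fderiv_toGraph_eq_zero hk hK (Filter.mem_of_superset (isOpen_ball.mem_nhds hz)
    ball_subset_closedBall) hd

end JetSpace

theorem theorem1p2 (n k : ℕ) (hn : 1 ≤ n) (hk : 1 ≤ k) :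
    ∃ f : Metric.sphere (0 : EuclideanSpace ℝ (Fin (n + 1))) 1 → JetSpace n k,
      JetSpace.IsLipschitz f ∧
      ¬ ∃ g : Metric.closedBall (0 : EuclideanSpace ℝ (Fin (n + 1))) 1 → JetSpace n k,
          JetSpace.IsLipschitz g ∧
          ∀ x : Metric.sphere (0 : EuclideanSpace ℝ (Fin (n + 1))) 1,
            g ⟨x.1, Metric.sphere_subset_closedBall x.2⟩ = f x := by
  -- The support of `β` is so small that the cube `(supp β)ⁿ⁺¹` does not meet the unit sphere.
  let β : ContDiffBump (0 : ℝ) :=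
    ⟨1 / (4 * (n + 1 : ℕ) : ℝ), 1 / (2 * (n + 1 : ℕ) : ℝ), by positivity, by
      gcongr
      norm_num⟩
  have hβ : ContDiff ℝ (⊤ : ℕ∞) β := β.contDiff
  obtain ⟨θ, hθ, hθβ⟩ := exists_contDiff_deriv_eq hβ
  have hsmooth := JetSpace.contDiff_bumpJet (n := n) (k := k) hθ hβ
  have hout : ∀ t, β.rOut < |t| → t ∉ tsupport β := by
    intro t ht
    rw [β.tsupport_eq, mem_closedBall_zero_iff, Real.norm_eq_abs]
    exact not_le.2 ht
  refine ⟨fun z => JetSpace.bumpJet n k θ β z, ?_, ?_⟩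
  · refine JetSpace.isLipschitz_restrict_sphere (by simpa using Nat.pos_of_ne_zero (by lia)) hsmooth fun z hz v =>
      JetSpace.fderiv_bumpJet_mem_horizontal hθ hβ (fun I => ?_) v
    obtain ⟨i, hi⟩ := exists_lt_abs_of_mem_sphere z (mem_sphere_zero_iff_norm.1 hz)
    have hi' := hout _ hi
    rw [hθβ]
    refine Fin.cases (fun h => ?_) (fun j h => ?_) i hi'
    · rw [image_eq_zero_of_notMem_tsupport h, zero_mul]
    · rw [Finset.prod_eq_zero (Finset.mem_univ j)
        (iteratedDeriv_eq_zero_of_notMem_tsupport h _), mul_zero]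
  · rintro ⟨g, hg, hgf⟩
    classical
    let g' : EuclideanSpace ℝ (Fin (n + 1)) → JetSpace n k := fun z =>
      if h : z ∈ closedBall (0 : EuclideanSpace ℝ (Fin (n + 1))) 1 then g ⟨z, h⟩ else 0
    have hg' : (fun z : closedBall (0 : EuclideanSpace ℝ (Fin (n + 1))) 1 => g' z) = g := by
      funext z
      simp only [g', z.2, dif_pos, Subtype.coe_eta]
    refine JetSpace.not_isLipschitz_of_integral_det_ne_zero hk hsmooth ?_ (g := g')
      (fun z hz => ?_) (by rwa [hg'])
    · refine ne_of_gt ?_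
      simp only [JetSpace.det_fderiv_toGraph_bumpJet hθ hβ, hθβ]
      have hcont : Continuous fun z : EuclideanSpace ℝ (Fin (n + 1)) =>
          β (z 0) * ∏ i : Fin n, β (z i.succ) := by
        have := β.continuous
        fun_prop
      rw [setIntegral_pos_iff_support_of_nonneg_ae]
      · refine IsOpen.measure_pos _ (hcont.isOpen_support.inter isOpen_ball) ⟨0, ?_, by simp⟩
        have h0 : β 0 = 1 := β.one_of_mem_closedBall (by simpa using β.rIn_pos.le)
        simp [h0]
      · exact Filter.Eventually.of_forall fun z =>
          mul_nonneg β.nonneg (Finset.prod_nonneg fun _ _ => β.nonneg)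
      · exact (hcont.continuousOn.integrableOn_compact (isCompact_closedBall _ _)).mono_set
          ball_subset_closedBall
    · simp only [g', sphere_subset_closedBall hz, dif_pos]
      exact hgf ⟨z, hz⟩
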